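/- Let $(X,\mu)$ and $(Y,\nu)$ be standard ($\sigma$-finite) measure spaces, $H$ a separable Hilbert space and $A\subseteq\mathcal B(H)$ a $C^*$-algebra. For $k\in L_2(Y\times X,\mathcal B(H))$ (that is, $k$ weakly measurable with $\int\|k\|^2<\infty$) let $T_k:L_2(X,H)\to L_2(Y,H)$ be the operator $(T_k\xi)(y)=\int_X k(y,x)\xi(x)\,d\mu(x)$, and let $\mathcal S_2(Y\times X,A)=\{T_k:k\in L_2(Y\times X,A)\}$, where $L_2(Y\times X,A)$ is the Bochner space of (strongly measurable) square-integrable $A$-valued functions; it is an operator space as a subspace of $\mathcal B(L_2(X,H),L_2(Y,H))$. Let $\varphi:X\times Y\to CB(A,\mathcal B(H))$ be a compact Schur $A$-multiplier, i.e. $\sup_{x,y}\|\varphi(x,y)\|_{cb}<\infty$, for every $a\in A$ the function $(x,y)\mapsto\varphi(x,y)(a)$ is weakly measurable, and the map $S_\varphi:T_k\mapsto T_{\varphi\cdot k}$ on $\mathcal S_2(Y\times X,A)$, where $(\varphi\cdot k)(y,x)=\varphi(x,y)(k(y,x))$, is completely bounded and (its continuous extension to the norm closure of $\mathcal S_2(Y\times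 X,A)$, as a map into $\mathcal B(L_2(X,H),L_2(Y,H))$) is compact. If $(X,\mu)$ or $(Y,\nu)$ is non-atomic, then for every $a\in A$ we have $\varphi(x,y)(a)=0$ for $(\mu\times\nu)$-almost all $(x,y)\in X\times Y$. Moreover, if $A$ is separable, then $\varphi(x,y)=0$ for $(\mu\times\nu)$-almost all $(x,y)\in X\times Y$. -/

import Mathlib

set_option linter.unusedSectionVars false

open MeasureTheory Filter Topology
open scoped InnerProductSpace ENNReal

namespace SchurMult

section Aux
variable {Ω : Type*} [MeasurableSpace Ω] {m : Measure Ω}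
variable {H : Type*} [NormedAddCommGroup H] [InnerProductSpace ℂ H] [CompleteSpace H]
  [TopologicalSpace.SeparableSpace H]

theorem countable_of_orthonormal {ι : Type*} {v : ι → H} (hv : Orthonormal ℂ v) :
    Countable ι := by
  rw [← Set.countable_univ_iff]
  refine Set.PairwiseDisjoint.countable_of_isOpen (s := fun i => Metric.ball (v i) (1/2)) ?_
    (fun i _ => Metric.isOpen_ball) (fun i _ => ⟨v i, by simp⟩)
  intro i _ j _ hij
  refine Metric.ball_disjoint_ball ?_
  have h1 : ‖v i - v j‖ ^ 2 = 2 := by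
    rw [@norm_sub_sq ℂ, hv.1 i, hv.1 j, hv.2 hij]; norm_num
  rw [dist_eq_norm]
  nlinarith [norm_nonneg (v i - v j)]

theorem aestronglyMeasurable_of_weak {f : Ω → H}
    (hf : ∀ h' : H, AEStronglyMeasurable (fun p => ⟪h', f p⟫_ℂ) m) :
    AEStronglyMeasurable f m := by
  obtain ⟨w, b, hb⟩ := exists_hilbertBasis ℂ H
  have : Countable w := countable_of_orthonormal b.orthonormal
  refine aestronglyMeasurable_of_tendsto_ae (atTop : Filter (Finset w))
    (f := fun s p => ∑ i ∈ s, ⟪b i, f p⟫_ℂ • b i) ?_ ?_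
  · intro s
    refine Finset.aestronglyMeasurable_fun_sum _ fun i _ => ?_
    exact (hf (b i)).smul_const (b i)
  · refine Eventually.of_forall fun p => ?_
    have := b.hasSum_repr (f p)
    simp only [b.repr_apply_apply] at this
    exact this

theorem aestronglyMeasurable_norm_clm {F : Type*} [NormedAddCommGroup F] [NormedSpace ℂ F]
    {k : Ω → H →L[ℂ] F} (hk : ∀ h, AEStronglyMeasurable (fun p => k p h) m) :
    AEStronglyMeasurable (fun p => ‖k p‖) m := by
  have key : ∀ T : H →L[ℂ] F, ‖T‖ₑ =
      ⨆ n, ‖T (TopologicalSpace.denseSeq H n)‖ₑ * ‖TopologicalSpace.denseSeq H n‖ₑ⁻¹ := by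
    intro T
    apply le_antisymm
    · set S := ⨆ n, ‖T (TopologicalSpace.denseSeq H n)‖ₑ * ‖TopologicalSpace.denseSeq H n‖ₑ⁻¹
      by_cases hS : S = ⊤
      · simp [hS]
      have hd : ∀ n, ‖T (TopologicalSpace.denseSeq H n)‖ ≤
          S.toReal * ‖TopologicalSpace.denseSeq H n‖ := by
        intro n
        by_cases h0 : TopologicalSpace.denseSeq H n = 0
        · simp [h0]
        have h1 : ‖T (TopologicalSpace.denseSeq H n)‖ₑ * ‖TopologicalSpace.denseSeq H n‖ₑ⁻¹ ≤ S :=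
          le_iSup (fun n => ‖T (TopologicalSpace.denseSeq H n)‖ₑ *
            ‖TopologicalSpace.denseSeq H n‖ₑ⁻¹) n
        have h2 := ENNReal.toReal_mono hS h1
        rw [ENNReal.toReal_mul, ENNReal.toReal_inv] at h2
        simp only [toReal_enorm] at h2
        have h3 : 0 < ‖TopologicalSpace.denseSeq H n‖ := norm_pos_iff.2 h0
        rwa [← div_eq_mul_inv, div_le_iff₀ h3] at h2
      have hall : ∀ x, ‖T x‖ ≤ S.toReal * ‖x‖ := by
        intro x
        refine (TopologicalSpace.denseRange_denseSeq H).induction_on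
          (p := fun x => ‖T x‖ ≤ S.toReal * ‖x‖) x ?_ hd
        exact isClosed_le (by fun_prop) (by fun_prop)
      have := T.opNorm_le_bound ENNReal.toReal_nonneg hall
      rw [← ofReal_norm]
      exact ENNReal.ofReal_le_of_le_toReal this
    · refine iSup_le fun n => ?_
      rw [← div_eq_mul_inv]
      refine ENNReal.div_le_of_le_mul ?_
      rw [← ofReal_norm, ← ofReal_norm, ← ofReal_norm,
        ← ENNReal.ofReal_mul (norm_nonneg _)]
      exact ENNReal.ofReal_le_ofReal (T.le_opNorm _)
  have h : AEMeasurable (fun p => ‖k p‖ₑ) m := by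
    simp_rw [key]
    exact AEMeasurable.iSup fun n => ((hk _).enorm.mul_const _)
  have := h.ennreal_toReal
  simp only [toReal_enorm] at this
  exact this.aestronglyMeasurable

theorem aestronglyMeasurable_apply {E F : Type*} [NormedAddCommGroup E] [TopologicalSpace F]
    [TopologicalSpace.PseudoMetrizableSpace F] {k : Ω → E → F} {g : Ω → E}
    (hc : ∀ p, Continuous (k p)) (hk : ∀ v, AEStronglyMeasurable (fun p => k p v) m)
    (hg : AEStronglyMeasurable g m) : AEStronglyMeasurable (fun p => k p (g p)) m := by
  have hs : ∀ s : SimpleFunc Ω E, AEStronglyMeasurable (fun p => k p (s p)) m := by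
    intro s
    have hU : (⋃ v : s.range, s ⁻¹' {v.1}) = Set.univ := by
      ext p; simp
    rw [← Measure.restrict_univ (μ := m), ← hU, aestronglyMeasurable_iUnion_iff]
    rintro ⟨v, hv⟩
    refine ((hk v).mono_measure Measure.restrict_le_self).congr ?_
    filter_upwards [ae_restrict_mem (s.measurableSet_fiber v)] with p hp
    rw [show s p = v from hp]
  refine aestronglyMeasurable_of_tendsto_ae atTop
    (f := fun n p => k p (hg.stronglyMeasurable_mk.approx n p)) (fun n => hs _) ?_
  filter_upwards [hg.ae_eq_mk] with p hp
  rw [hp]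
  exact ((hc p).tendsto _).comp (hg.stronglyMeasurable_mk.tendsto_approx p)

end Aux

section OperatorSpaces

variable {E F E' F' : Type*}
  [NormedAddCommGroup E] [InnerProductSpace ℂ E] [NormedAddCommGroup F] [InnerProductSpace ℂ F]
  [NormedAddCommGroup E'] [InnerProductSpace ℂ E'] [NormedAddCommGroup F'] [InnerProductSpace ℂ F']

/-- The operator `Eⁿ → Fⁿ` between Hilbert space direct sums defined by an `n × n` matrix with
entries in `B(E, F)`; its norm is the norm of the matrix in `M_n(B(E, F))`. -/
noncomputable def matOp {n : ℕ} (M : Matrix (Fin n) (Fin n) (E →L[ℂ] F)) :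
    PiLp 2 (fun _ : Fin n => E) →L[ℂ] PiLp 2 (fun _ : Fin n => F) :=
  (PiLp.continuousLinearEquiv 2 ℂ (fun _ : Fin n => F)).symm.toContinuousLinearMap ∘L
    ContinuousLinearMap.pi fun i => ∑ j, M i j ∘L PiLp.proj 2 (fun _ : Fin n => E) j

theorem matOp_apply {n : ℕ} (M : Matrix (Fin n) (Fin n) (E →L[ℂ] F))
    (ξ : PiLp 2 (fun _ : Fin n => E)) (i : Fin n) : matOp M ξ i = ∑ j, M i j (ξ j) := by
  simp [matOp]

/-- `‖f‖_cb ≤ C`, for a linear map `f` from a (concrete) operator space `V ⊆ B(E, F)` into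
`B(E', F')`: all the amplifications `f_n : M_n(V) → M_n(B(E', F'))` are bounded by `C`. -/
def CBNormLE {V : Submodule ℂ (E →L[ℂ] F)} (f : V →ₗ[ℂ] (E' →L[ℂ] F')) (C : ℝ) : Prop :=
  ∀ (n : ℕ) (M : Matrix (Fin n) (Fin n) V),
    ‖matOp (M.map f)‖ ≤ C * ‖matOp (M.map fun v => (v : E →L[ℂ] F))‖

/-- Complete boundedness of a linear map on a concrete operator space. -/
def IsCompletelyBounded {V : Submodule ℂ (E →L[ℂ] F)} (f : V →ₗ[ℂ] (E' →L[ℂ] F')) : Prop :=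
  ∃ C, CBNormLE f C

/-- The set `CB(V, B(E', F'))` of completely bounded linear maps. -/
def CB (V : Submodule ℂ (E →L[ℂ] F)) (E' F' : Type*)
    [NormedAddCommGroup E'] [InnerProductSpace ℂ E']
    [NormedAddCommGroup F'] [InnerProductSpace ℂ F'] : Type _ :=
  {f : V →ₗ[ℂ] (E' →L[ℂ] F') // IsCompletelyBounded f}

theorem norm_matOp_one (M : Matrix (Fin 1) (Fin 1) (E →L[ℂ] F)) : ‖matOp M‖ = ‖M 0 0‖ := by
  have hn : ∀ {G : Type _} [NormedAddCommGroup G] [InnerProductSpace ℂ G]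
      (ξ : PiLp 2 (fun _ : Fin 1 => G)), ‖ξ‖ = ‖ξ 0‖ := by
    intro G _ _ ξ
    rw [PiLp.norm_eq_of_L2]
    simp
  have hn' : ∀ (ξ : PiLp 2 (fun _ : Fin 1 => E)), ‖ξ‖ = ‖ξ 0‖ := by
    intro ξ
    rw [PiLp.norm_eq_of_L2]
    simp
  apply le_antisymm
  · refine ContinuousLinearMap.opNorm_le_bound _ (norm_nonneg _) fun ξ => ?_
    rw [hn, hn', matOp_apply]
    simpa using (M 0 0).le_opNorm (ξ 0)
  · refine ContinuousLinearMap.opNorm_le_bound _ (norm_nonneg (matOp M)) fun v => ?_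
    have h := (matOp M).le_opNorm (WithLp.toLp 2 fun _ => v)
    rw [hn, hn', matOp_apply] at h
    simpa using h

theorem CBNormLE.norm_le {V : Submodule ℂ (E →L[ℂ] F)} {f : V →ₗ[ℂ] (E' →L[ℂ] F')} {C : ℝ}
    (hf : CBNormLE f C) (v : V) : ‖f v‖ ≤ C * ‖v‖ := by
  have := hf 1 (Matrix.of fun _ _ => v)
  rw [norm_matOp_one, norm_matOp_one] at this
  simpa using this

theorem CBNormLE.continuous {V : Submodule ℂ (E →L[ℂ] F)} {f : V →ₗ[ℂ] (E' →L[ℂ] F')} {C : ℝ}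
    (hf : CBNormLE f C) : Continuous f :=
  (f.mkContinuous C hf.norm_le).continuous

end OperatorSpaces

section Kernel
variable {X Y : Type*} [MeasurableSpace X] [MeasurableSpace Y]
variable {H : Type*} [NormedAddCommGroup H] [InnerProductSpace ℂ H]

/-- Square-integrable operator-valued kernels `k ∈ L₂(Y × X, B(H))`: `k` is weakly measurable and
`‖k(·)‖` is square integrable. (As usual for functions that matter only up to null sets,
measurability is with respect to the completed product measure.) -/
structure IsL2Kernel (μ : Measure X) (ν : Measure Y) (k : Y × X → H →L[ℂ] H) : Prop where
  weaklyMeasurable : ∀ h h' : H, AEStronglyMeasurable (fun p => ⟪h', k p h⟫_ℂ) (ν.prod μ)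
  memLp_norm : MemLp (fun p => ‖k p‖) 2 (ν.prod μ)

variable [CompleteSpace H] [TopologicalSpace.SeparableSpace H]
variable {μ : Measure X} {ν : Measure Y} [SigmaFinite μ] [SigmaFinite ν]

theorem IsL2Kernel.aestronglyMeasurable_apply {k : Y × X → H →L[ℂ] H} (hk : IsL2Kernel μ ν k)
    {ξ : X → H} (hξ : AEStronglyMeasurable ξ μ) :
    AEStronglyMeasurable (fun p : Y × X => k p (ξ p.2)) (ν.prod μ) :=
  SchurMult.aestronglyMeasurable_apply (k := fun p h => k p h) (g := fun p : Y × X => ξ p.2)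
    (fun p => (k p).continuous)
    (fun v => aestronglyMeasurable_of_weak (hk.weaklyMeasurable v))
    (hξ.comp_quasiMeasurePreserving Measure.quasiMeasurePreserving_snd)

theorem IsL2Kernel.ae_memLp {k : Y × X → H →L[ℂ] H} (hk : IsL2Kernel μ ν k) :
    ∀ᵐ y ∂ν, MemLp (fun x => ‖k (y, x)‖) 2 μ := by
  filter_upwards [hk.memLp_norm.1.prodMk_left, hk.memLp_norm.integrable_sq.prod_right_ae]
    with y h1 h2
  exact (memLp_two_iff_integrable_sq h1).2 h2

theorem IsL2Kernel.ae_integrable {k : Y × X → H →L[ℂ] H} (hk : IsL2Kernel μ ν k)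
    {ξ : X → H} (hξ : MemLp ξ 2 μ) :
    ∀ᵐ y ∂ν, Integrable (fun x => k (y, x) (ξ x)) μ := by
  filter_upwards [(hk.aestronglyMeasurable_apply hξ.1).prodMk_left, hk.ae_memLp] with y h1 h2
  refine (h2.integrable_mul hξ.norm).mono' h1 (Eventually.of_forall fun x => ?_)
  exact (k (y, x)).le_opNorm _

/-- The function `y ↦ ∫ k(y,x) ξ(x) dμ(x)`. -/
noncomputable def kernelFun (μ : Measure X) (k : Y × X → H →L[ℂ] H) (ξ : X → H) (y : Y) : H :=
  ∫ x, k (y, x) (ξ x) ∂μ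

theorem IsL2Kernel.eLpNorm_kernelFun_le {k : Y × X → H →L[ℂ] H} (hk : IsL2Kernel μ ν k)
    {ξ : X → H} (hξ : MemLp ξ 2 μ) :
    eLpNorm (kernelFun μ k ξ) 2 ν ≤
      eLpNorm (fun p => ‖k p‖) 2 (ν.prod μ) * eLpNorm ξ 2 μ := by
  have h2 : ((2 : ℝ≥0∞)).toReal = 2 := by norm_num
  rw [eLpNorm_eq_lintegral_rpow_enorm_toReal (by norm_num) (by norm_num),
    eLpNorm_eq_lintegral_rpow_enorm_toReal (by norm_num) (by norm_num),
    eLpNorm_eq_lintegral_rpow_enorm_toReal (by norm_num) (by norm_num), h2,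
    ← ENNReal.mul_rpow_of_nonneg _ _ (by norm_num)]
  refine ENNReal.rpow_le_rpow ?_ (by norm_num)
  have hm : AEMeasurable (fun p : Y × X => ‖‖k p‖‖ₑ ^ (2 : ℝ)) (ν.prod μ) :=
    hk.memLp_norm.1.enorm.pow_const _
  rw [lintegral_prod _ hm, ← lintegral_mul_const'' _ hm.lintegral_prod_right']
  refine lintegral_mono_ae ?_
  filter_upwards [hk.memLp_norm.1.prodMk_left] with y hy
  have h3 : ‖kernelFun μ k ξ y‖ₑ ≤
      (∫⁻ x, ‖‖k (y, x)‖‖ₑ ^ (2 : ℝ) ∂μ) ^ (1 / (2 : ℝ)) *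
        (∫⁻ x, ‖ξ x‖ₑ ^ (2 : ℝ) ∂μ) ^ (1 / (2 : ℝ)) := by
    refine (enorm_integral_le_lintegral_enorm _).trans (le_trans (lintegral_mono fun x => ?_)
      (ENNReal.lintegral_mul_le_Lp_mul_Lq μ Real.HolderConjugate.two_two hy.enorm hξ.1.enorm))
    simp only [Pi.mul_apply, enorm_norm]
    exact (k (y, x)).le_opENorm _
  refine (ENNReal.rpow_le_rpow h3 (by norm_num : (0 : ℝ) ≤ 2)).trans (le_of_eq ?_)
  rw [ENNReal.mul_rpow_of_nonneg _ _ (by norm_num), ← ENNReal.rpow_mul, ← ENNReal.rpow_mul]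
  norm_num

theorem IsL2Kernel.memLp_kernelFun {k : Y × X → H →L[ℂ] H} (hk : IsL2Kernel μ ν k)
    {ξ : X → H} (hξ : MemLp ξ 2 μ) : MemLp (kernelFun μ k ξ) 2 ν :=
  ⟨(hk.aestronglyMeasurable_apply hξ.1).integral_prod_right',
    (hk.eLpNorm_kernelFun_le hξ).trans_lt (ENNReal.mul_lt_top hk.memLp_norm.2 hξ.2)⟩

theorem IsL2Kernel.norm_toLp_kernelFun_le {k : Y × X → H →L[ℂ] H} (hk : IsL2Kernel μ ν k)
    (ξ : Lp H 2 μ) : ‖(hk.memLp_kernelFun (Lp.memLp ξ)).toLp‖ ≤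
      (eLpNorm (fun p => ‖k p‖) 2 (ν.prod μ)).toReal * ‖ξ‖ := by
  rw [Lp.norm_toLp, Lp.norm_def, ← ENNReal.toReal_mul]
  exact ENNReal.toReal_mono (ENNReal.mul_ne_top hk.memLp_norm.2.ne (Lp.memLp ξ).2.ne)
    (hk.eLpNorm_kernelFun_le (Lp.memLp ξ))

/-- The integral operator `T_k : L₂(X, H) → L₂(Y, H)`, `(T_k ξ)(y) = ∫ k(y,x) ξ(x) dμ(x)`. -/
noncomputable def kernelOp {k : Y × X → H →L[ℂ] H} (hk : IsL2Kernel μ ν k) :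
    Lp H 2 μ →L[ℂ] Lp H 2 ν :=
  LinearMap.mkContinuous
    { toFun := fun ξ => (hk.memLp_kernelFun (Lp.memLp ξ)).toLp
      map_add' := fun ξ η => by
        rw [← MemLp.toLp_add, MemLp.toLp_eq_toLp_iff]
        filter_upwards [hk.ae_integrable (Lp.memLp ξ), hk.ae_integrable (Lp.memLp η)] with y h1 h2
        simp only [kernelFun, Pi.add_apply]
        rw [← integral_add h1 h2]
        refine integral_congr_ae ?_
        filter_upwards [Lp.coeFn_add ξ η] with x hx
        rw [hx, Pi.add_apply, map_add]
      map_smul' := fun c ξ => by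
        rw [RingHom.id_apply, ← MemLp.toLp_const_smul, MemLp.toLp_eq_toLp_iff]
        refine Eventually.of_forall fun y => ?_
        simp only [kernelFun, Pi.smul_apply]
        rw [← integral_smul]
        refine integral_congr_ae ?_
        filter_upwards [Lp.coeFn_smul c ξ] with x hx
        rw [hx, Pi.smul_apply, map_smul] }
    (eLpNorm (fun p => ‖k p‖) 2 (ν.prod μ)).toReal
    (fun ξ =>
      hk.norm_toLp_kernelFun_le ξ)

theorem coeFn_kernelOp {k : Y × X → H →L[ℂ] H} (hk : IsL2Kernel μ ν k) (ξ : Lp H 2 μ) :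
    kernelOp hk ξ =ᵐ[ν] fun y => ∫ x, k (y, x) (ξ x) ∂μ :=
  (hk.memLp_kernelFun (Lp.memLp ξ)).coeFn_toLp

theorem kernelOp_congr {k k' : Y × X → H →L[ℂ] H} (hk : IsL2Kernel μ ν k)
    (hk' : IsL2Kernel μ ν k') (h : k =ᵐ[ν.prod μ] k') : kernelOp hk = kernelOp hk' := by
  ext1 ξ
  apply Lp.ext
  filter_upwards [coeFn_kernelOp hk ξ, coeFn_kernelOp hk' ξ, Measure.ae_ae_of_ae_prod h]
    with y h1 h2 h3
  rw [h1, h2]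
  refine integral_congr_ae ?_
  filter_upwards [h3] with x hx
  rw [hx]

theorem kernelOp_add {k k' l : Y × X → H →L[ℂ] H} (hk : IsL2Kernel μ ν k)
    (hk' : IsL2Kernel μ ν k') (hl : IsL2Kernel μ ν l) (h : l =ᵐ[ν.prod μ] k + k') :
    kernelOp hl = kernelOp hk + kernelOp hk' := by
  ext1 ξ
  apply Lp.ext
  rw [_root_.add_apply]
  filter_upwards [coeFn_kernelOp hk ξ, coeFn_kernelOp hk' ξ, coeFn_kernelOp hl ξ,
    Measure.ae_ae_of_ae_prod h, Lp.coeFn_add (kernelOp hk ξ) (kernelOp hk' ξ),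
    hk.ae_integrable (Lp.memLp ξ), hk'.ae_integrable (Lp.memLp ξ)]
    with y h1 h2 h3 h4 h5 h6 h7
  rw [h3, h5, Pi.add_apply, h1, h2, ← integral_add h6 h7]
  refine integral_congr_ae ?_
  filter_upwards [h4] with x hx
  rw [hx, Pi.add_apply, _root_.add_apply]

theorem kernelOp_smul {k l : Y × X → H →L[ℂ] H} (c : ℂ) (hk : IsL2Kernel μ ν k)
    (hl : IsL2Kernel μ ν l) (h : l =ᵐ[ν.prod μ] c • k) :
    kernelOp hl = c • kernelOp hk := by
  ext1 ξ
  apply Lp.ext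
  rw [_root_.smul_apply]
  filter_upwards [coeFn_kernelOp hk ξ, coeFn_kernelOp hl ξ,
    Measure.ae_ae_of_ae_prod h, Lp.coeFn_smul c (kernelOp hk ξ)] with y h1 h3 h4 h5
  rw [h3, h5, Pi.smul_apply, h1, ← integral_smul]
  refine integral_congr_ae ?_
  filter_upwards [h4] with x hx
  rw [hx, Pi.smul_apply, _root_.smul_apply]

theorem ae_eq_zero_of_kernelOp_eq_zero {k : Y × X → H →L[ℂ] H} (hk : IsL2Kernel μ ν k)
    (h0 : kernelOp hk = 0) : k =ᵐ[ν.prod μ] 0 := by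
  have hscal : ∀ h h' : H, (fun p => ⟪h', k p h⟫_ℂ) =ᵐ[ν.prod μ] 0 := by
    intro h h'
    have hL2 : MemLp (fun p => ⟪h', k p h⟫_ℂ) 2 (ν.prod μ) := by
      refine (hk.memLp_norm.const_mul (‖h'‖ * ‖h‖)).of_le (hk.weaklyMeasurable h h')
        (Eventually.of_forall fun p => ?_)
      refine (norm_inner_le_norm _ _).trans ?_
      rw [Real.norm_of_nonneg (by positivity), mul_assoc, mul_comm ‖h‖]
      exact mul_le_mul_of_nonneg_left ((k p).le_opNorm h) (norm_nonneg _)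
    have hfin : ∀ n, (ν.prod μ) (spanningSets ν n ×ˢ spanningSets μ n) ≠ ∞ := by
      intro n
      rw [Measure.prod_prod]
      exact (ENNReal.mul_lt_top (measure_spanningSets_lt_top ν n)
        (measure_spanningSets_lt_top μ n)).ne
    have hrect : ∀ (F : Set Y) (E : Set X), MeasurableSet F → MeasurableSet E → ν F < ∞ →
        μ E < ∞ → ∫ p in F ×ˢ E, ⟪h', k p h⟫_ℂ ∂(ν.prod μ) = 0 := by
      intro F E hF hE hFf hEf
      have hint : IntegrableOn (fun p => ⟪h', k p h⟫_ℂ) (F ×ˢ E) (ν.prod μ) := by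
        have : IsFiniteMeasure ((ν.prod μ).restrict (F ×ˢ E)) := by
          rw [isFiniteMeasure_restrict, Measure.prod_prod]
          exact (ENNReal.mul_lt_top hFf hEf).ne
        exact (hL2.restrict _).integrable one_le_two
      rw [setIntegral_prod _ hint]
      have h1 := coeFn_kernelOp hk (indicatorConstLp 2 hE hEf.ne h)
      rw [h0, _root_.zero_apply] at h1
      have h2 : ∀ᵐ y ∂ν, ∫ x in E, ⟪h', k (y, x) h⟫_ℂ ∂μ = 0 := by
        filter_upwards [h1, Lp.coeFn_zero H 2 ν,
          hk.ae_integrable (Lp.memLp (indicatorConstLp 2 hE hEf.ne h))] with y hy hy0 hyi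
        have hcong : (fun x => k (y, x) (indicatorConstLp 2 hE hEf.ne h x)) =ᵐ[μ]
            E.indicator (fun x => k (y, x) h) := by
          filter_upwards [indicatorConstLp_coeFn (p := 2) (hs := hE) (hμs := hEf.ne) (c := h)]
            with x hx
          rw [hx]
          by_cases hxE : x ∈ E <;> simp [hxE]
        rw [hy0, Pi.zero_apply, integral_congr_ae hcong, integral_indicator hE] at hy
        have hi : IntegrableOn (fun x => k (y, x) h) E μ :=
          (integrable_indicator_iff hE).1 (hyi.congr hcong)
        rw [integral_inner hi, ← hy, inner_zero_right]
      rw [setIntegral_eq_zero_of_ae_eq_zero]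
      filter_upwards [h2] with y hy _ using hy
    have hB : ∀ n, ∀ᵐ p ∂((ν.prod μ).restrict (spanningSets ν n ×ˢ spanningSets μ n)),
        ⟪h', k p h⟫_ℂ = 0 := by
      intro n
      set B := spanningSets ν n ×ˢ spanningSets μ n with hBdef
      have hBm : MeasurableSet B :=
        (measurableSet_spanningSets ν n).prod (measurableSet_spanningSets μ n)
      have : IsFiniteMeasure ((ν.prod μ).restrict B) := isFiniteMeasure_restrict.2 (hfin n)
      have hint : Integrable (fun p => ⟪h', k p h⟫_ℂ) ((ν.prod μ).restrict B) :=
        (hL2.restrict _).integrable one_le_two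
      have hBz : ∫ p in B, ⟪h', k p h⟫_ℂ ∂(ν.prod μ) = 0 :=
        hrect _ _ (measurableSet_spanningSets ν n) (measurableSet_spanningSets μ n)
          (measure_spanningSets_lt_top ν n) (measure_spanningSets_lt_top μ n)
      refine hint.ae_eq_zero_of_forall_setIntegral_eq_zero fun s hs _ => ?_
      clear * - hs hint hBz hrect hBdef
      induction s, hs using MeasurableSpace.induction_on_inter generateFrom_prod.symm
        isPiSystem_prod with
      | empty => simp
      | basic t ht =>
        obtain ⟨F, hF, E, hE, rfl⟩ := ht
        rw [Measure.restrict_restrict (MeasurableSet.prod hF hE), hBdef, Set.prod_inter_prod]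
        exact hrect _ _ (MeasurableSet.inter hF (measurableSet_spanningSets ν n))
          (MeasurableSet.inter hE (measurableSet_spanningSets μ n))
          ((measure_mono Set.inter_subset_right).trans_lt (measure_spanningSets_lt_top ν n))
          ((measure_mono Set.inter_subset_right).trans_lt (measure_spanningSets_lt_top μ n))
      | compl t htm iht =>
        have := integral_add_compl htm hint
        rw [iht, zero_add, hBz] at this
        exact this
      | iUnion f hd hfm ihf =>
        rw [integral_iUnion hfm hd hint.integrableOn]
        simp [ihf]
    have hU : (⋃ n, spanningSets ν n ×ˢ spanningSets μ n) = Set.univ := by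
      rw [Set.iUnion_prod_of_monotone (monotone_spanningSets ν) (monotone_spanningSets μ),
        iUnion_spanningSets, iUnion_spanningSets, Set.univ_prod_univ]
    rw [Filter.EventuallyEq, ← Measure.restrict_univ (μ := ν.prod μ), ← hU, ae_restrict_iUnion_iff]
    exact hB
  have hall : ∀ᵐ p ∂(ν.prod μ), ∀ i j : ℕ,
      ⟪TopologicalSpace.denseSeq H j, k p (TopologicalSpace.denseSeq H i)⟫_ℂ = 0 :=
    ae_all_iff.2 fun i => ae_all_iff.2 fun j => hscal _ _
  filter_upwards [hall] with p hp
  have hv : ∀ i, k p (TopologicalSpace.denseSeq H i) = 0 := by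
    intro i
    refine (TopologicalSpace.denseRange_denseSeq H).eq_zero_of_inner_left ℂ ?_
    intro j
    rw [← inner_conj_symm, hp i j, map_zero]
  ext1 v
  refine (TopologicalSpace.denseRange_denseSeq H).induction_on
    (p := fun x => k p x = (0 : H →L[ℂ] H) x) v ?_ ?_
  · exact isClosed_eq (by fun_prop) (by fun_prop)
  · intro i; simpa using hv i

end Kernel
section Schur

variable {X Y : Type*} [MeasurableSpace X] [MeasurableSpace Y]
variable {H : Type*} [NormedAddCommGroup H] [InnerProductSpace ℂ H]

/-- Bounded, pointwise measurable functions `φ : X × Y → CB(V, B(H))`: for every `a ∈ V` the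
function `(x, y) ↦ φ(x, y)(a)` is weakly measurable, and `sup ‖φ(x, y)‖_cb < ∞`. -/
structure IsBoundedPointwiseMeasurable (μ : Measure X) (ν : Measure Y)
    {V : Submodule ℂ (H →L[ℂ] H)} (φ : X × Y → CB V H H) : Prop where
  pointwiseMeasurable : ∀ (a : V) (h h' : H),
    AEStronglyMeasurable (fun p => ⟪h', (φ p).1 a h⟫_ℂ) (μ.prod ν)
  bounded : ∃ C, ∀ p, CBNormLE (φ p).1 C

/-- The kernel `(φ · k)(y, x) = φ(x, y)(k(y, x))`. -/
def mulKernel {V : Submodule ℂ (H →L[ℂ] H)} (φ : X × Y → CB V H H) (k : Y × X → V) :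
    Y × X → H →L[ℂ] H :=
  fun p => (φ (p.2, p.1)).1 (k p)

variable [CompleteSpace H] [TopologicalSpace.SeparableSpace H]
variable {μ : Measure X} {ν : Measure Y} [SigmaFinite μ] [SigmaFinite ν]

theorem isL2Kernel_coe {V : Submodule ℂ (H →L[ℂ] H)} {k : Y × X → V}
    (hk : MemLp k 2 (ν.prod μ)) : IsL2Kernel μ ν (fun p => (k p : H →L[ℂ] H)) where
  weaklyMeasurable h h' := by
    have hc : Continuous fun v : V => ⟪h', (v : H →L[ℂ] H) h⟫_ℂ := by fun_prop
    exact hc.comp_aestronglyMeasurable hk.1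
  memLp_norm := hk.norm

theorem IsBoundedPointwiseMeasurable.isL2Kernel_mulKernel {V : Submodule ℂ (H →L[ℂ] H)}
    {φ : X × Y → CB V H H} (hφ : IsBoundedPointwiseMeasurable μ ν φ) {k : Y × X → V}
    (hk : MemLp k 2 (ν.prod μ)) : IsL2Kernel μ ν (mulKernel φ k) := by
  obtain ⟨C, hC⟩ := hφ.bounded
  have hw : ∀ h h' : H,
      AEStronglyMeasurable (fun p => ⟪h', mulKernel φ k p h⟫_ℂ) (ν.prod μ) := by
    intro h h'
    refine aestronglyMeasurable_apply
      (k := fun (p : Y × X) (v : V) => ⟪h', (φ (p.2, p.1)).1 v h⟫_ℂ) (fun p => ?_) (fun v => ?_) hk.1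
    · have := (hC (p.2, p.1)).continuous
      fun_prop
    · exact (hφ.pointwiseMeasurable v h h').comp_quasiMeasurePreserving
        (Measure.measurePreserving_swap (μ := ν) (ν := μ)).quasiMeasurePreserving
  refine ⟨hw, (hk.norm.const_mul C).of_le (f := fun p => ‖mulKernel φ k p‖)
    (aestronglyMeasurable_norm_clm fun h => aestronglyMeasurable_of_weak (hw h))
    (Eventually.of_forall fun p => ?_)⟩
  rw [norm_norm]
  exact ((hC _).norm_le _).trans (le_abs_self _)

/-- The map `k ↦ T_k` on `L₂(Y × X, V)`. -/
noncomputable def kernelOpₗ (μ : Measure X) (ν : Measure Y) [SigmaFinite μ] [SigmaFinite ν]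
    (V : Submodule ℂ (H →L[ℂ] H)) :
    Lp V 2 (ν.prod μ) →ₗ[ℂ] (Lp H 2 μ →L[ℂ] Lp H 2 ν) where
  toFun k := kernelOp (isL2Kernel_coe (Lp.memLp k))
  map_add' k l := kernelOp_add _ _ _ (by
    filter_upwards [Lp.coeFn_add k l] with p hp
    rw [hp]; rfl)
  map_smul' c k := kernelOp_smul c _ _ (by
    filter_upwards [Lp.coeFn_smul c k] with p hp
    rw [hp]; rfl)

theorem kernelOpₗ_injective (V : Submodule ℂ (H →L[ℂ] H)) :
    Function.Injective (kernelOpₗ μ ν V) := by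
  rw [injective_iff_map_eq_zero]
  intro k hk
  apply Lp.ext
  filter_upwards [ae_eq_zero_of_kernelOp_eq_zero (isL2Kernel_coe (Lp.memLp k)) hk,
    Lp.coeFn_zero V 2 (ν.prod μ)] with p hp h0
  rw [h0]
  exact Subtype.ext hp

/-- The map `k ↦ T_{φ·k}` on `L₂(Y × X, V)`. -/
noncomputable def mulKernelOpₗ {V : Submodule ℂ (H →L[ℂ] H)} {φ : X × Y → CB V H H}
    (hφ : IsBoundedPointwiseMeasurable μ ν φ) :
    Lp V 2 (ν.prod μ) →ₗ[ℂ] (Lp H 2 μ →L[ℂ] Lp H 2 ν) where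
  toFun k := kernelOp (hφ.isL2Kernel_mulKernel (Lp.memLp k))
  map_add' k l := kernelOp_add _ _ _ (by
    filter_upwards [Lp.coeFn_add k l] with p hp
    simp only [mulKernel, hp, Pi.add_apply, map_add])
  map_smul' c k := kernelOp_smul c _ _ (by
    filter_upwards [Lp.coeFn_smul c k] with p hp
    simp only [mulKernel, hp, Pi.smul_apply, map_smul])

/-- The operator space `S₂(Y × X, V) = {T_k : k ∈ L₂(Y × X, V)} ⊆ B(L₂(X, H), L₂(Y, H))`, with the
operator norm. -/
noncomputable abbrev S₂ (μ : Measure X) (ν : Measure Y) [SigmaFinite μ] [SigmaFinite ν]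
    (V : Submodule ℂ (H →L[ℂ] H)) : Submodule ℂ (Lp H 2 μ →L[ℂ] Lp H 2 ν) :=
  LinearMap.range (kernelOpₗ μ ν V)

/-- The linear map `S_φ` on `S₂(Y × X, V)`, `S_φ(T_k) = T_{φ·k}`. -/
noncomputable def schurMap {V : Submodule ℂ (H →L[ℂ] H)} {φ : X × Y → CB V H H}
    (hφ : IsBoundedPointwiseMeasurable μ ν φ) :
    S₂ μ ν V →ₗ[ℂ] (Lp H 2 μ →L[ℂ] Lp H 2 ν) :=
  mulKernelOpₗ hφ ∘ₗ
    (LinearEquiv.ofInjective (kernelOpₗ μ ν V) (kernelOpₗ_injective V)).symm.toLinearMap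

theorem schurMap_apply {V : Submodule ℂ (H →L[ℂ] H)} {φ : X × Y → CB V H H}
    (hφ : IsBoundedPointwiseMeasurable μ ν φ) {k : Y × X → V} (hk : MemLp k 2 (ν.prod μ))
    (hT : kernelOp (isL2Kernel_coe hk) ∈ S₂ μ ν V) :
    schurMap hφ ⟨kernelOp (isL2Kernel_coe hk), hT⟩ = kernelOp (hφ.isL2Kernel_mulKernel hk) := by
  have h1 : (⟨kernelOp (isL2Kernel_coe hk), hT⟩ : S₂ μ ν V) =
      LinearEquiv.ofInjective (kernelOpₗ μ ν V) (kernelOpₗ_injective V) hk.toLp := by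
    apply Subtype.ext
    refine kernelOp_congr (isL2Kernel_coe hk) (isL2Kernel_coe (Lp.memLp hk.toLp)) ?_
    filter_upwards [hk.coeFn_toLp] with p hp
    rw [hp]
  rw [h1, schurMap, LinearMap.comp_apply, LinearEquiv.coe_coe, LinearEquiv.symm_apply_apply]
  refine kernelOp_congr (hφ.isL2Kernel_mulKernel (Lp.memLp hk.toLp)) _ ?_
  filter_upwards [hk.coeFn_toLp] with p hp
  simp only [mulKernel, hp]

/-- Schur `V`-multipliers: bounded pointwise measurable `φ` such that `S_φ` is completely
bounded. -/
def IsSchurMultiplier (μ : Measure X) (ν : Measure Y) [SigmaFinite μ] [SigmaFinite ν]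
    {V : Submodule ℂ (H →L[ℂ] H)} (φ : X × Y → CB V H H) : Prop :=
  ∃ hφ : IsBoundedPointwiseMeasurable μ ν φ, IsCompletelyBounded (schurMap hφ)

/-- Compact Schur `V`-multipliers. Compactness of `S_φ` is tested in the complete space
`B(L₂(X, H), L₂(Y, H))`: a neighbourhood of zero in `S₂(Y × X, V)` is mapped into a compact set of
operators. This is the same as compactness of the continuous extension of `S_φ` to the norm closure
of `S₂(Y × X, V)`. -/
def IsCompactSchurMultiplier (μ : Measure X) (ν : Measure Y) [SigmaFinite μ] [SigmaFinite ν]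
    {V : Submodule ℂ (H →L[ℂ] H)} (φ : X × Y → CB V H H) : Prop :=
  ∃ hφ : IsBoundedPointwiseMeasurable μ ν φ,
    IsCompletelyBounded (schurMap hφ) ∧ IsCompactOperator (schurMap hφ)

end Schur

end SchurMult

namespace SchurMult

/-! ### Weak-* null sequences of unimodular functions on a non-atomic space. -/

section WeaklyNull

/-! Suppose `μ` is non-atomic. There are unimodular functions `u n` on `X` tending to zero weak-* in
`L∞` (`exists_isUnimodularWeaklyNull`): transport an equivalent probability measure to Haar measure
on the circle and pull back the characters. The multiplication unitaries `M n` on `L₂(X, H)` then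
tend to zero in the weak operator topology.

For a square-integrable kernel `k` put `K = T_{φ·k}`. The kernels `u n • k` give operators of
bounded norm, and since each `φ(x, y)` is linear, `S_φ` sends them to `K ∘ M n`. Compactness yields
a norm-convergent subsequence. Its limit is also a weak limit, hence zero; but composing with a
unitary preserves the norm, so `K = 0` (`eq_zero_of_tendsto_comp_isometryEquiv`). If `ν` is the
non-atomic measure, the unitaries act on the left instead.

A kernel is determined almost everywhere by its operator, so `φ · k = 0` a.e. for every `k`. Kernels
equal to `a` on sets of finite measure give the claim for each `a`; a countable dense set and
continuity of `φ(x, y)` give the separable case. -/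

theorem continuous_cdf (ρ : Measure ℝ) [IsProbabilityMeasure ρ] [NullSingletonClass ρ] :
    Continuous (ProbabilityTheory.cdf ρ) := by
  refine continuous_iff_continuousAt.2 fun a => ?_
  rw [(ProbabilityTheory.cdf ρ).mono.continuousAt_iff_leftLim_eq_rightLim,
    StieltjesFunction.rightLim_eq]
  -- The jump at `a` is the mass of `{a}`, which vanishes.
  have h := (ProbabilityTheory.cdf ρ).measure_singleton a
  rw [ProbabilityTheory.measure_cdf, measure_singleton, eq_comm, ENNReal.ofReal_eq_zero] at h
  exact le_antisymm ((ProbabilityTheory.cdf ρ).mono.leftLim_le le_rfl) (by linarith)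

/-- The distribution function of an atomless probability measure on `ℝ` pushes it forward to the
uniform distribution. -/
theorem measurePreserving_cdf (ρ : Measure ℝ) [IsProbabilityMeasure ρ] [NullSingletonClass ρ] :
    MeasurePreserving (ProbabilityTheory.cdf ρ) ρ (volume.restrict (Set.Ioc 0 (0 + 1))) := by
  have hc := continuous_cdf ρ
  -- Intermediate values. The endpoints 0 and 1 may be only limits, so both inequalities below are
  -- proved for nearby `t'` and passed to the limit.
  have hrange : ∀ t : ℝ, 0 < t → t < 1 → ∃ s, ProbabilityTheory.cdf ρ s = t := fun t h0 h1 =>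
    mem_range_of_exists_le_of_exists_ge hc
      (((ProbabilityTheory.tendsto_cdf_atBot ρ).eventually_le_const h0).exists)
      (((ProbabilityTheory.tendsto_cdf_atTop ρ).eventually_const_le h1).exists)
  refine ⟨hc.measurable, ?_⟩
  have := Measure.isProbabilityMeasure_map (μ := ρ) hc.measurable.aemeasurable
  refine Measure.ext_of_Iic _ _ fun t => ?_
  rw [Measure.map_apply hc.measurable measurableSet_Iic, Measure.restrict_apply measurableSet_Iic]
  have hI : Set.Iic t ∩ Set.Ioc (0 : ℝ) (0 + 1) = Set.Ioc 0 (min t 1) := by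
    ext x; simp only [Set.mem_inter_iff, Set.mem_Iic, Set.mem_Ioc, le_min_iff, zero_add]; tauto
  rw [hI, Real.volume_Ioc, sub_zero]
  apply le_antisymm
  · rcases le_or_gt 1 t with h1 | h1
    · rw [min_eq_right h1, ENNReal.ofReal_one]
      exact prob_le_one
    rw [min_eq_left h1.le]
    rcases lt_or_ge t 0 with h0 | h0
    · have : ProbabilityTheory.cdf ρ ⁻¹' Set.Iic t = ∅ := by
        ext x
        simpa using h0.trans_le (ProbabilityTheory.cdf_nonneg ρ x)
      simp [this]
    -- If the distribution function equals `t' > t` at `s`, then its sublevel set at `t` lies in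
    -- `Iic s`, which has mass `t'`.
    have hle : ∀ t', t < t' → t' < 1 →
        ρ (ProbabilityTheory.cdf ρ ⁻¹' Set.Iic t) ≤ ENNReal.ofReal t' := by
      intro t' h h'
      obtain ⟨s, hs⟩ := hrange t' (h0.trans_lt h) h'
      rw [← hs, ProbabilityTheory.ofReal_cdf]
      refine measure_mono fun x hx => ?_
      by_contra hxs
      have h2 := ProbabilityTheory.monotone_cdf ρ (not_le.1 hxs).le
      rw [hs] at h2
      exact absurd (h.trans_le h2) (not_lt.2 hx)
    refine ge_of_tendsto (x := 𝓝[>] t)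
      ((ENNReal.continuous_ofReal.tendsto t).mono_left nhdsWithin_le_nhds) ?_
    filter_upwards [Ioo_mem_nhdsGT h1] with t' ht' using hle t' ht'.1 ht'.2
  -- Conversely, a point `s` with value `t' < t` has `Iic s` inside the sublevel set.
  · have hlt : ∀ t', t' < min t 1 →
        ENNReal.ofReal t' ≤ ρ (ProbabilityTheory.cdf ρ ⁻¹' Set.Iic t) := by
      intro t' h
      rcases le_or_gt t' 0 with h0 | h0
      · simp [ENNReal.ofReal_of_nonpos h0]
      obtain ⟨s, hs⟩ := hrange t' h0 (h.trans_le (min_le_right _ _))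
      rw [← hs, ProbabilityTheory.ofReal_cdf]
      refine measure_mono fun x hx => ?_
      exact (ProbabilityTheory.monotone_cdf ρ hx).trans
        (hs.le.trans (h.le.trans (min_le_left _ _)))
    refine le_of_tendsto (x := 𝓝[<] (min t 1))
      ((ENNReal.continuous_ofReal.tendsto _).mono_left nhdsWithin_le_nhds) ?_
    filter_upwards [self_mem_nhdsWithin] with t' ht' using hlt t' ht'

variable {X : Type*} [MeasurableSpace X]

/-- A sequence of unimodular functions converging to zero weak-`*` in `L∞`. -/
structure IsUnimodularWeaklyNull (μ : Measure X) (u : ℕ → X → ℂ) : Prop where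
  measurable : ∀ n, Measurable (u n)
  norm_eq_one : ∀ n x, ‖u n x‖ = 1
  tendsto_integral : ∀ g : X → ℂ, Integrable g μ →
    Tendsto (fun n => ∫ x, u n x * g x ∂μ) atTop (𝓝 0)

/-- An embedding into `ℝ` gives an atomless law, its distribution function makes this uniform on the
unit interval, and wrapping the interval gives Haar measure. -/
theorem exists_measurePreserving_addCircle [StandardBorelSpace X] (μ : Measure X)
    [IsProbabilityMeasure μ] [NullSingletonClass μ] :
    ∃ f : X → AddCircle (1 : ℝ), MeasurePreserving f μ AddCircle.haarAddCircle := by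
  have he := measurableEmbedding_embeddingReal X
  set ρ := μ.map (embeddingReal X) with hρ
  have : IsProbabilityMeasure ρ := Measure.isProbabilityMeasure_map he.measurable.aemeasurable
  have : NullSingletonClass ρ := ⟨fun x => by
    rw [hρ, Measure.map_apply he.measurable (measurableSet_singleton x)]
    exact (Set.subsingleton_singleton.preimage he.injective).measure_zero μ⟩
  have hvol : (volume : Measure (AddCircle (1 : ℝ))) = AddCircle.haarAddCircle := by
    rw [AddCircle.volume_eq_smul_haarAddCircle, ENNReal.ofReal_one, one_smul]
  have h1 : MeasurePreserving (embeddingReal X) μ ρ := ⟨he.measurable, rfl⟩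
  -- This map starts from `Ioc 0 (0 + 1)`, whence the form of the target in `measurePreserving_cdf`.
  have h2 := AddCircle.measurePreserving_mk (1 : ℝ) 0
  rw [hvol] at h2
  exact ⟨_, h2.comp ((measurePreserving_cdf ρ).comp h1)⟩

/-- A Riemann–Lebesgue argument: the pulled-back characters are orthonormal, so Bessel's inequality
handles `g` in `L₂`, and density extends this to `L₁` because `‖u n x‖ = 1`. -/
theorem exists_isUnimodularWeaklyNull_of_isProbabilityMeasure [StandardBorelSpace X]
    (μ : Measure X) [IsProbabilityMeasure μ] [NullSingletonClass μ] :
    ∃ u, IsUnimodularWeaklyNull μ u := by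
  obtain ⟨f, hf⟩ := exists_measurePreserving_addCircle μ
  set u : ℕ → X → ℂ := fun n x => fourier (n : ℤ) (f x) with hu
  have hum : ∀ n, Measurable (u n) := fun n =>
    (fourier (n : ℤ)).continuous.measurable.comp hf.measurable
  have hun : ∀ n x, ‖u n x‖ = 1 := fun n x => Circle.norm_coe _
  have hL2 : ∀ g : X → ℂ, MemLp g 2 μ → Tendsto (fun n => ∫ x, u n x * g x ∂μ) atTop (𝓝 0) := by
    intro g hg
    have ho : Orthonormal ℂ fun n : ℕ =>
        Lp.compMeasurePreservingₗᵢ ℂ f hf (fourierLp (T := (1 : ℝ)) 2 (n : ℤ)) :=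
      ((orthonormal_fourier (T := (1 : ℝ))).comp_linearIsometry _).comp
        (fun n : ℕ => (n : ℤ)) Nat.cast_injective
    have hs := (ho.inner_products_summable (hg.star).toLp).tendsto_atTop_zero
    have hs' : Tendsto (fun n : ℕ => ‖⟪Lp.compMeasurePreservingₗᵢ ℂ f hf
        (fourierLp (T := (1 : ℝ)) 2 (n : ℤ)), (hg.star).toLp⟫_ℂ‖) atTop (𝓝 0) := by
      have := hs.sqrt
      simpa [Real.sqrt_sq] using this
    rw [tendsto_zero_iff_norm_tendsto_zero]
    refine hs'.congr fun n => ?_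
    rw [L2.inner_def, ← RCLike.norm_conj (∫ x, u n x * g x ∂μ), ← integral_conj]
    congr 1
    refine integral_congr_ae ?_
    filter_upwards [(hg.star).coeFn_toLp,
      Lp.coeFn_compMeasurePreserving (fourierLp (T := (1 : ℝ)) 2 (n : ℤ)) hf,
      hf.quasiMeasurePreserving.ae_eq_comp (coeFn_fourierLp (T := (1 : ℝ)) 2 (n : ℤ))]
      with x h1 h2 h3
    change ⟪(Lp.compMeasurePreserving f hf (fourierLp (T := (1 : ℝ)) 2 (n : ℤ)) : X → ℂ) x, _⟫_ℂ = _
    rw [h1, h2, h3]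
    simp [hu, mul_comm]
  refine ⟨u, hum, hun, fun g hg => ?_⟩
  rw [Metric.tendsto_atTop]
  intro ε hε
  -- Simple functions are in `L₂` here, and the error `g - s` contributes less than `ε / 2`
  -- uniformly in `n`.
  obtain ⟨s, hs, hsm⟩ := (memLp_one_iff_integrable.2 hg).exists_simpleFunc_eLpNorm_sub_lt
    ENNReal.one_ne_top (ε := ENNReal.ofReal (ε / 2)) (by simpa using hε)
  obtain ⟨N, hN⟩ := Metric.tendsto_atTop.1
    (hL2 s (s.memLp_of_isFiniteMeasure 2 μ)) (ε / 2) (half_pos hε)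
  refine ⟨N, fun n hn => ?_⟩
  have hsi := memLp_one_iff_integrable.1 hsm
  have hmul : ∀ {g : X → ℂ}, Integrable g μ → Integrable (fun x => u n x * g x) μ := fun hg =>
    hg.bdd_mul (c := 1) (hum n).aestronglyMeasurable
      (Eventually.of_forall fun x => (hun n x).le)
  have h1 := hN n hn
  rw [dist_zero_right] at h1 ⊢
  have h2 : ‖∫ x, u n x * (g x - s x) ∂μ‖ < ε / 2 := by
    refine (norm_integral_le_integral_norm _).trans_lt ?_
    simp only [norm_mul, hun, one_mul]
    rw [eLpNorm_one_eq_lintegral_enorm, ← ofReal_integral_norm_eq_lintegral_enorm (hg.sub hsi),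
      ENNReal.ofReal_lt_ofReal_iff (half_pos hε)] at hs
    exact hs
  have h3 : ∫ x, u n x * g x ∂μ = (∫ x, u n x * (g x - s x) ∂μ) + ∫ x, u n x * s x ∂μ := by
    have hgs : Integrable (fun x => g x - s x) μ := hg.sub hsi
    rw [← integral_add (hmul hgs) (hmul hsi)]
    exact integral_congr_ae (Eventually.of_forall fun x => by ring)
  rw [h3]
  exact (norm_add_le _ _).trans_lt (by linarith)

/-- Weak-* nullity depends only on the measure class: the density of `μ` with respect to the
equivalent measure `μ.toFinite` can be absorbed into `g`. -/
theorem exists_isUnimodularWeaklyNull [StandardBorelSpace X] (μ : Measure X) [SigmaFinite μ]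
    [NullSingletonClass μ] : ∃ u, IsUnimodularWeaklyNull μ u := by
  -- `μ.toFinite` is a probability measure only for `μ ≠ 0`.
  rcases eq_zero_or_neZero μ with rfl | hμ
  · exact ⟨fun _ _ => 1, fun _ => measurable_const, fun _ _ => by simp, fun g _ => by simp⟩
  have : NullSingletonClass μ.toFinite :=
    ⟨fun x => toFinite_absolutelyContinuous μ (measure_singleton x)⟩
  obtain ⟨u, hum, hun, hu⟩ := exists_isUnimodularWeaklyNull_of_isProbabilityMeasure μ.toFinite
  have hac := absolutelyContinuous_toFinite μ
  refine ⟨u, hum, hun, fun g hg => ?_⟩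
  refine (hu _ ((integrable_rnDeriv_smul_iff hac).2 hg)).congr fun n => ?_
  rw [← integral_rnDeriv_smul hac]
  refine integral_congr_ae (Eventually.of_forall fun x => ?_)
  simp only [mul_smul_comm]

end WeaklyNull

/-! ### Sequential form of compactness. -/

section CompactOperator

theorem exists_tendsto_of_isCompactOperator {E F E' F' : Type*}
    [NormedAddCommGroup E] [InnerProductSpace ℂ E] [NormedAddCommGroup F] [InnerProductSpace ℂ F]
    [NormedAddCommGroup E'] [InnerProductSpace ℂ E']
    [NormedAddCommGroup F'] [InnerProductSpace ℂ F']
    {W : Submodule ℂ (E →L[ℂ] F)} (f : W →ₗ[ℂ] (E' →L[ℂ] F'))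
    (hf : IsCompactOperator f) {x : ℕ → W} {R : ℝ} (hx : ∀ n, ‖(x n : E →L[ℂ] F)‖ ≤ R) :
    ∃ L, ∃ σ : ℕ → ℕ, StrictMono σ ∧ Tendsto (fun n => f (x (σ n))) atTop (𝓝 L) := by
  obtain ⟨K, hK, hsub⟩ :=
    IsCompactOperator.image_subset_compact_of_isVonNBounded (𝕜₁ := ℂ) (f := f) hf
      (S := Metric.closedBall 0 R) (NormedSpace.isVonNBounded_closedBall ℂ W R)
  obtain ⟨L, -, σ, hσ, hL⟩ := hK.tendsto_subseq (x := fun n => f (x n)) fun n =>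
    hsub ⟨x n, mem_closedBall_zero_iff.2 (hx n), rfl⟩
  exact ⟨L, σ, hσ, hL⟩

end CompactOperator

/-! ### Composition with weakly null unitaries. -/

section WeaklyNullUnitaries

variable {E F : Type*} [NormedAddCommGroup E] [InnerProductSpace ℂ E] [CompleteSpace E]
  [NormedAddCommGroup F] [InnerProductSpace ℂ F] [CompleteSpace F]

/-- The operators `K ∘ M n` tend weakly to zero, so a norm limit must vanish, yet their norms never
drop below `‖K‖`. -/
theorem eq_zero_of_tendsto_comp_isometryEquiv {K L : E →L[ℂ] F} {M : ℕ → E ≃ₗᵢ[ℂ] E}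
    (hM : ∀ η ξ, Tendsto (fun n => ⟪η, M n ξ⟫_ℂ) atTop (𝓝 0))
    {Kₙ : ℕ → E →L[ℂ] F} (hK : ∀ n ξ, Kₙ n ξ = K (M n ξ)) {σ : ℕ → ℕ}
    (hσ : Tendsto σ atTop atTop) (hL : Tendsto (Kₙ ∘ σ) atTop (𝓝 L)) : K = 0 := by
  have hL0 : L = 0 := by
    ext1 ξ
    refine ext_inner_left ℂ fun η => ?_
    have h1 : Tendsto (fun n => ⟪η, Kₙ (σ n) ξ⟫_ℂ) atTop (𝓝 ⟪η, L ξ⟫_ℂ) :=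
      tendsto_const_nhds.inner (((ContinuousLinearMap.apply ℂ F ξ).continuous.tendsto L).comp hL)
    -- The adjoint moves `K` away from `M n ξ`, where weak nullity applies.
    have h2 := (hM (K.adjoint η) ξ).comp hσ
    simp only [_root_.zero_apply, inner_zero_right]
    refine tendsto_nhds_unique h1 (h2.congr fun n => ?_)
    simp only [Function.comp_apply, hK, ContinuousLinearMap.adjoint_inner_left]
  -- Every vector is `M n` of a vector of the same norm.
  have hle : ∀ n, ‖K‖ ≤ ‖Kₙ n‖ := fun n =>
    K.opNorm_le_bound (norm_nonneg _) fun ξ => by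
      simpa [hK] using (Kₙ n).le_opNorm ((M n).symm ξ)
  have := ge_of_tendsto hL.norm (Eventually.of_forall fun n => hle (σ n))
  rw [hL0, norm_zero] at this
  exact norm_le_zero_iff.1 this

/-- The left-handed counterpart; weak nullity applies directly to the fixed vector `K ξ`, so no
adjoint is needed. -/
theorem eq_zero_of_tendsto_isometryEquiv_comp {K L : E →L[ℂ] F} {M : ℕ → F ≃ₗᵢ[ℂ] F}
    (hM : ∀ η ξ, Tendsto (fun n => ⟪η, M n ξ⟫_ℂ) atTop (𝓝 0))
    {Kₙ : ℕ → E →L[ℂ] F} (hK : ∀ n ξ, Kₙ n ξ = M n (K ξ)) {σ : ℕ → ℕ}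
    (hσ : Tendsto σ atTop atTop) (hL : Tendsto (Kₙ ∘ σ) atTop (𝓝 L)) : K = 0 := by
  have hL0 : L = 0 := by
    ext1 ξ
    refine ext_inner_left ℂ fun η => ?_
    have h1 : Tendsto (fun n => ⟪η, Kₙ (σ n) ξ⟫_ℂ) atTop (𝓝 ⟪η, L ξ⟫_ℂ) :=
      tendsto_const_nhds.inner (((ContinuousLinearMap.apply ℂ F ξ).continuous.tendsto L).comp hL)
    have h2 := (hM η (K ξ)).comp hσ
    simp only [_root_.zero_apply, inner_zero_right]
    refine tendsto_nhds_unique h1 (h2.congr fun n => ?_)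
    simp only [Function.comp_apply, hK]
  have hle : ∀ n, ‖K‖ ≤ ‖Kₙ n‖ := fun n =>
    K.opNorm_le_bound (norm_nonneg _) fun ξ => by
      simpa [hK] using (Kₙ n).le_opNorm ξ
  have := ge_of_tendsto hL.norm (Eventually.of_forall fun n => hle (σ n))
  rw [hL0, norm_zero] at this
  exact norm_le_zero_iff.1 this

end WeaklyNullUnitaries

/-! ### Multiplication unitaries on `L₂(X, H)`. -/

section Multiplication

variable {X : Type*} [MeasurableSpace X] {μ : Measure X}
variable {H : Type*} [NormedAddCommGroup H] [InnerProductSpace ℂ H]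

theorem memLp_unimodular_smul {u : X → ℂ} (hu : Measurable u) (hu1 : ∀ x, ‖u x‖ = 1)
    (ξ : Lp H 2 μ) : MemLp (fun x => u x • ξ x) 2 μ :=
  (Lp.memLp ξ).of_le (hu.aestronglyMeasurable.smul (Lp.memLp ξ).1)
    (Eventually.of_forall fun x => by rw [norm_smul, hu1, one_mul])

/-- Multiplication by a unimodular function, as a unitary operator on `L₂(X, H)`. -/
noncomputable def unimodularMul {u : X → ℂ} (hu : Measurable u) (hu1 : ∀ x, ‖u x‖ = 1) :
    Lp H 2 μ ≃ₗᵢ[ℂ] Lp H 2 μ where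
  toFun ξ := (memLp_unimodular_smul hu hu1 ξ).toLp
  invFun ξ := (memLp_unimodular_smul (u := fun x => star (u x)) (continuous_star.measurable.comp hu)
    (fun x => by rw [norm_star, hu1]) ξ).toLp
  map_add' ξ η := by
    rw [← MemLp.toLp_add, MemLp.toLp_eq_toLp_iff]
    filter_upwards [Lp.coeFn_add ξ η] with x hx
    rw [hx, Pi.add_apply, smul_add, Pi.add_apply]
  map_smul' c ξ := by
    rw [RingHom.id_apply, ← MemLp.toLp_const_smul, MemLp.toLp_eq_toLp_iff]
    filter_upwards [Lp.coeFn_smul c ξ] with x hx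
    rw [hx, Pi.smul_apply, smul_comm, Pi.smul_apply]
  left_inv ξ := by
    apply Lp.ext
    refine (MemLp.coeFn_toLp _).trans ?_
    filter_upwards [(memLp_unimodular_smul hu hu1 ξ).coeFn_toLp] with x hx
    rw [hx, smul_smul]
    simp [Complex.conj_mul', hu1]
  right_inv ξ := by
    apply Lp.ext
    refine (MemLp.coeFn_toLp _).trans ?_
    filter_upwards [(memLp_unimodular_smul (u := fun x => star (u x)) (continuous_star.measurable.comp hu)
      (fun x => by rw [norm_star, hu1]) ξ).coeFn_toLp] with x hx
    rw [hx, smul_smul]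
    simp [Complex.mul_conj', hu1]
  norm_map' ξ := by
    change ‖(memLp_unimodular_smul hu hu1 ξ).toLp‖ = _
    rw [Lp.norm_toLp, Lp.norm_def]
    congr 1
    refine eLpNorm_congr_norm_ae (Eventually.of_forall fun x => ?_)
    rw [norm_smul, hu1, one_mul]

theorem coeFn_unimodularMul {u : X → ℂ} (hu : Measurable u) (hu1 : ∀ x, ‖u x‖ = 1)
    (ξ : Lp H 2 μ) : unimodularMul hu hu1 ξ =ᵐ[μ] fun x => u x • ξ x :=
  (memLp_unimodular_smul hu hu1 ξ).coeFn_toLp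

/-- The pointwise inner product of two `L₂` functions is integrable, so it is a legitimate test
function for weak-* nullity. -/
theorem IsUnimodularWeaklyNull.tendsto_inner {u : ℕ → X → ℂ} (hu : IsUnimodularWeaklyNull μ u)
    (η ξ : Lp H 2 μ) :
    Tendsto (fun n => ⟪η, unimodularMul (hu.measurable n) (hu.norm_eq_one n) ξ⟫_ℂ)
      atTop (𝓝 0) := by
  refine (hu.tendsto_integral _ (L2.integrable_inner (𝕜 := ℂ) η ξ)).congr fun n => ?_
  rw [L2.inner_def]
  refine integral_congr_ae ?_
  filter_upwards [coeFn_unimodularMul (hu.measurable n) (hu.norm_eq_one n) ξ] with x hx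
  rw [hx, inner_smul_right]

end Multiplication

/-! ### Vanishing of compact Schur multipliers. -/

section Kernel

variable {X Y : Type*} [MeasurableSpace X] [MeasurableSpace Y]
variable {H : Type*} [NormedAddCommGroup H] [InnerProductSpace ℂ H] [CompleteSpace H]
  [TopologicalSpace.SeparableSpace H]
variable {μ : Measure X} {ν : Measure Y} [SigmaFinite μ] [SigmaFinite ν]

/-- A scalar depending on `x` alone passes through the linear map `k (y, x)` onto `ξ`. -/
theorem kernelOp_unimodular_smul_snd {u : X → ℂ} (hu : Measurable u) (hu1 : ∀ x, ‖u x‖ = 1)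
    {k l : Y × X → H →L[ℂ] H} (hk : IsL2Kernel μ ν k) (hl : IsL2Kernel μ ν l)
    (h : ∀ p, l p = u p.2 • k p) (ξ : Lp H 2 μ) :
    kernelOp hl ξ = kernelOp hk (unimodularMul hu hu1 ξ) := by
  apply Lp.ext
  filter_upwards [coeFn_kernelOp hl ξ, coeFn_kernelOp hk (unimodularMul hu hu1 ξ)] with y h1 h2
  rw [h1, h2]
  refine integral_congr_ae ?_
  filter_upwards [coeFn_unimodularMul hu hu1 ξ] with x hx
  rw [hx, h, map_smul, _root_.smul_apply]

/-- A scalar depending on `y` alone comes out of the integral over `x`. -/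
theorem kernelOp_unimodular_smul_fst {u : Y → ℂ} (hu : Measurable u) (hu1 : ∀ y, ‖u y‖ = 1)
    {k l : Y × X → H →L[ℂ] H} (hk : IsL2Kernel μ ν k) (hl : IsL2Kernel μ ν l)
    (h : ∀ p, l p = u p.1 • k p) (ξ : Lp H 2 μ) :
    kernelOp hl ξ = unimodularMul hu hu1 (kernelOp hk ξ) := by
  apply Lp.ext
  filter_upwards [coeFn_kernelOp hl ξ, coeFn_kernelOp hk ξ,
    coeFn_unimodularMul hu hu1 (kernelOp hk ξ)] with y h1 h2 h3
  rw [h1, h3, h2, ← integral_smul]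
  simp only [h, _root_.smul_apply]

theorem norm_kernelOp_le {k : Y × X → H →L[ℂ] H} (hk : IsL2Kernel μ ν k) :
    ‖kernelOp hk‖ ≤ (eLpNorm (fun p => ‖k p‖) 2 (ν.prod μ)).toReal :=
  (kernelOp hk).opNorm_le_bound ENNReal.toReal_nonneg fun ξ => hk.norm_toLp_kernelFun_le ξ

variable {V : Submodule ℂ (H →L[ℂ] H)}

theorem kernelOp_mem_S₂ {k : Y × X → V} (hk : MemLp k 2 (ν.prod μ)) :
    kernelOp (isL2Kernel_coe hk) ∈ S₂ μ ν V := by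
  refine ⟨hk.toLp, kernelOp_congr (isL2Kernel_coe (Lp.memLp hk.toLp)) (isL2Kernel_coe hk) ?_⟩
  filter_upwards [hk.coeFn_toLp] with p hp
  rw [hp]

/-- The images under a compact Schur map of the kernels `w n • k`, with `w n` unimodular, have a
convergent subsequence. -/
theorem exists_tendsto_kernelOp_mulKernel {φ : X × Y → CB V H H}
    (hφ : IsBoundedPointwiseMeasurable μ ν φ) (hc : IsCompactOperator (schurMap hφ))
    {k : Y × X → V} {w : ℕ → Y × X → ℂ} (hw1 : ∀ n p, ‖w n p‖ = 1)
    (hwk : ∀ n, MemLp (fun p => w n p • k p) 2 (ν.prod μ)) :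
    ∃ L, ∃ σ : ℕ → ℕ, StrictMono σ ∧
      Tendsto ((fun n => kernelOp (hφ.isL2Kernel_mulKernel (hwk n))) ∘ σ) atTop (𝓝 L) := by
  have hmem : ∀ n, kernelOp (isL2Kernel_coe (hwk n)) ∈ S₂ μ ν V :=
    fun n => kernelOp_mem_S₂ (hwk n)
  have hle : ∀ n, ‖kernelOp (isL2Kernel_coe (hwk n))‖ ≤
      (eLpNorm (fun p => ‖k p‖) 2 (ν.prod μ)).toReal := by
    intro n
    refine (norm_kernelOp_le (isL2Kernel_coe (hwk n))).trans (le_of_eq ?_)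
    congr 1
    refine eLpNorm_congr_norm_ae (Eventually.of_forall fun p => ?_)
    simp [norm_smul, hw1]
  obtain ⟨L, σ, hσ, hL⟩ := exists_tendsto_of_isCompactOperator (schurMap hφ) hc
    (x := fun n => ⟨kernelOp (isL2Kernel_coe (hwk n)), hmem n⟩) hle
  refine ⟨L, σ, hσ, hL.congr fun n => ?_⟩
  exact schurMap_apply hφ (hwk (σ n)) (hmem (σ n))

theorem memLp_unimodular_smul_kernel {m : Measure (Y × X)} {k : Y × X → V} {w : Y × X → ℂ}
    (hw : Measurable w) (hw1 : ∀ p, ‖w p‖ = 1) (hk : MemLp k 2 m) :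
    MemLp (fun p => w p • k p) 2 m :=
  hk.of_le (hw.aestronglyMeasurable.smul hk.1)
    (Eventually.of_forall fun p => by rw [norm_smul, hw1, one_mul])

/-- Makes `S_φ` commute with multiplication operators on either side. -/
theorem mulKernel_smul (φ : X × Y → CB V H H) (k : Y × X → V) (w : Y × X → ℂ) (p : Y × X) :
    mulKernel φ (fun p => w p • k p) p = w p • mulKernel φ k p :=
  map_smul _ _ _

theorem mulKernel_ae_eq_zero_of_isCompactOperator
    [StandardBorelSpace X] [StandardBorelSpace Y]
    (hatom : NullSingletonClass μ ∨ NullSingletonClass ν) {φ : X × Y → CB V H H}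
    (hφ : IsBoundedPointwiseMeasurable μ ν φ) (hc : IsCompactOperator (schurMap hφ))
    {k : Y × X → V} (hk : MemLp k 2 (ν.prod μ)) : mulKernel φ k =ᵐ[ν.prod μ] 0 := by
  refine ae_eq_zero_of_kernelOp_eq_zero (hφ.isL2Kernel_mulKernel hk) ?_
  rcases hatom with hμ | hν
  · obtain ⟨u, hu⟩ := exists_isUnimodularWeaklyNull μ
    have hwk := fun n => memLp_unimodular_smul_kernel (w := fun p : Y × X => u n p.2)
      ((hu.measurable n).comp measurable_snd) (fun p => hu.norm_eq_one n p.2) hk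
    obtain ⟨L, σ, hσ, hL⟩ := exists_tendsto_kernelOp_mulKernel hφ hc
      (fun n p => hu.norm_eq_one n p.2) hwk
    exact eq_zero_of_tendsto_comp_isometryEquiv hu.tendsto_inner
      (fun n ξ => kernelOp_unimodular_smul_snd (hu.measurable n) (hu.norm_eq_one n) _ _
        (mulKernel_smul φ k _) ξ) hσ.tendsto_atTop hL
  · obtain ⟨u, hu⟩ := exists_isUnimodularWeaklyNull ν
    have hwk := fun n => memLp_unimodular_smul_kernel (w := fun p : Y × X => u n p.1)
      ((hu.measurable n).comp measurable_fst) (fun p => hu.norm_eq_one n p.1) hk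
    obtain ⟨L, σ, hσ, hL⟩ := exists_tendsto_kernelOp_mulKernel hφ hc
      (fun n p => hu.norm_eq_one n p.1) hwk
    exact eq_zero_of_tendsto_isometryEquiv_comp hu.tendsto_inner
      (fun n ξ => kernelOp_unimodular_smul_fst (hu.measurable n) (hu.norm_eq_one n) _ _
        (mulKernel_smul φ k _) ξ) hσ.tendsto_atTop hL

/-- The constant kernel `a` need not be square integrable, so it is cut off to sets of finite
measure exhausting `Y × X`. -/
theorem ae_apply_eq_zero_of_isCompactOperator
    [StandardBorelSpace X] [StandardBorelSpace Y]
    (hatom : NullSingletonClass μ ∨ NullSingletonClass ν) {φ : X × Y → CB V H H}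
    (hφ : IsBoundedPointwiseMeasurable μ ν φ) (hc : IsCompactOperator (schurMap hφ)) (a : V) :
    ∀ᵐ p ∂(μ.prod ν), (φ p).1 a = 0 := by
  have h : ∀ᵐ p ∂(ν.prod μ), ∀ n, p ∈ spanningSets (ν.prod μ) n → (φ p.swap).1 a = 0 := by
    refine ae_all_iff.2 fun n => ?_
    have hk : MemLp ((spanningSets (ν.prod μ) n).indicator fun _ => a) 2 (ν.prod μ) :=
      memLp_indicator_const 2 (measurableSet_spanningSets _ n) a
        (Or.inr (measure_spanningSets_lt_top _ n).ne)
    filter_upwards [mulKernel_ae_eq_zero_of_isCompactOperator hatom hφ hc hk] with p hp hpn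
    simpa [mulKernel, hpn, Prod.swap] using hp
  -- Kernels live on `Y × X` but `φ` on `X × Y`.
  filter_upwards [Measure.measurePreserving_swap.quasiMeasurePreserving.ae h] with p hp
  obtain ⟨n, hn⟩ := Set.mem_iUnion.1
    ((iUnion_spanningSets (ν.prod μ)).symm ▸ Set.mem_univ p.swap)
  exact hp n hn

/-- The null set depends on `a`; countably many suffice because the cb bound makes every `φ(x, y)`
continuous. -/
theorem ae_eq_zero_of_isCompactOperator
    [StandardBorelSpace X] [StandardBorelSpace Y] [TopologicalSpace.SeparableSpace V]
    (hatom : NullSingletonClass μ ∨ NullSingletonClass ν) {φ : X × Y → CB V H H}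
    (hφ : IsBoundedPointwiseMeasurable μ ν φ) (hc : IsCompactOperator (schurMap hφ)) :
    ∀ᵐ p ∂(μ.prod ν), (φ p).1 = 0 := by
  obtain ⟨C, hC⟩ := hφ.bounded
  filter_upwards [ae_all_iff.2 fun n => ae_apply_eq_zero_of_isCompactOperator hatom hφ hc
    (TopologicalSpace.denseSeq V n)] with p hp
  refine LinearMap.ext fun a => ?_
  refine (TopologicalSpace.denseRange_denseSeq V).induction_on
    (p := fun a => (φ p).1 a = 0) a ?_ hp
  exact isClosed_eq (hC p).continuous continuous_const

end Kernel

end SchurMult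

/-! ### The main theorem. -/

theorem mainTheorem6 {X Y H : Type*}
    [MeasurableSpace X] [StandardBorelSpace X] [MeasurableSpace Y] [StandardBorelSpace Y]
    (μ : Measure X) (ν : Measure Y) [SigmaFinite μ] [SigmaFinite ν]
    [NormedAddCommGroup H] [InnerProductSpace ℂ H] [CompleteSpace H]
    [TopologicalSpace.SeparableSpace H]
    (A : NonUnitalStarSubalgebra ℂ (H →L[ℂ] H)) (hA : IsClosed (A : Set (H →L[ℂ] H)))
    (hatom : NullSingletonClass μ ∨ NullSingletonClass ν)
    (φ : X × Y → SchurMult.CB A.toNonUnitalSubalgebra.toSubmodule H H)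
    (hφ : SchurMult.IsCompactSchurMultiplier μ ν φ) :
    (∀ a, ∀ᵐ p ∂(μ.prod ν), (φ p).1 a = 0) ∧
      (TopologicalSpace.SeparableSpace A → ∀ᵐ p ∂(μ.prod ν), (φ p).1 = 0) := by
  obtain ⟨hφm, -, hc⟩ := hφ
  refine ⟨fun a => SchurMult.ae_apply_eq_zero_of_isCompactOperator hatom hφm hc a, fun hsep => ?_⟩
  have : TopologicalSpace.SeparableSpace A.toNonUnitalSubalgebra.toSubmodule := hsep
  exact SchurMult.ae_eq_zero_of_isCompactOperator hatom hφm hc
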